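/- For $S\subseteq\mathbb R^n$ and $d\ge 0$ let $\mathcal B_d(S)$ be the real vector space of all polynomials $p\in\mathbb R[x_1,\dots,x_n]$ for which there is a polynomial $q\in\mathbb R[x_1,\dots,x_n]$ of total degree at most $2d$ with $p^2\le q$ on $S$; in particular, $\mathcal B_0(S)$ consists of the polynomials that are bounded on $S$. Let $$S_1=\{(a,b)\in\mathbb R^2 \mid a\ge 1,\ 1\le a^3b+a^6-a\le 2\},\qquad S_2=\{(a,b)\in\mathbb R^2 \mid a\ge 1,\ 1\le a^3b-a^6-a\le 2\},$$ and $S=S_1\cup S_2$. Then $S$ is basic closed semialgebraic (the solution set in $\mathbb R^2$ of finitely many simultaneous non-strict polynomial inequalities) and regular (it contains an open subset of $\mathbb R^2$ that is dense in $S$), every polynomial bounded on $S$ is constant, i.e. $\mathcal B_0(S)=\mathbb R$, but the real vector space $\mathcal B_1(S)$ is infinite-dimensional. -/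

import Mathlib

/-- `GrowthModule S d` is the real vector space `B_d(S)` of those polynomials `p` in `n` variables
for which there is a polynomial `q` of total degree at most `2 * d` with `p ^ 2 ≤ q` on `S`. -/
def GrowthModule {n : ℕ} (S : Set (Fin n → ℝ)) (d : ℕ) :
    Submodule ℝ (MvPolynomial (Fin n) ℝ) where
  carrier := {p | ∃ q : MvPolynomial (Fin n) ℝ, q.totalDegree ≤ 2 * d ∧
    ∀ x ∈ S, MvPolynomial.eval x p ^ 2 ≤ MvPolynomial.eval x q}
  zero_mem' := ⟨0, by simp, fun x _ => by simp⟩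
  add_mem' := by
    rintro p p' ⟨q, hq, h⟩ ⟨q', hq', h'⟩
    refine ⟨(2 : ℝ) • (q + q'), ?_, fun x hx => ?_⟩
    · exact (MvPolynomial.totalDegree_smul_le _ _).trans
        ((MvPolynomial.totalDegree_add _ _).trans (max_le hq hq'))
    · rw [MvPolynomial.smul_eval, map_add, map_add]
      nlinarith [h x hx, h' x hx,
        sq_nonneg (MvPolynomial.eval x p - MvPolynomial.eval x p')]
  smul_mem' := by
    rintro c p ⟨q, hq, h⟩
    refine ⟨(c ^ 2) • q, (MvPolynomial.totalDegree_smul_le _ _).trans hq, fun x hx => ?_⟩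
    rw [MvPolynomial.smul_eval, MvPolynomial.smul_eval, mul_pow]
    exact mul_le_mul_of_nonneg_left (h x hx) (sq_nonneg c)

/-- A basic closed semialgebraic set: the solution set of finitely many simultaneous non-strict
polynomial inequalities. -/
def IsBasicClosed {n : ℕ} (S : Set (Fin n → ℝ)) : Prop :=
  ∃ F : Finset (MvPolynomial (Fin n) ℝ), S = {x | ∀ f ∈ F, 0 ≤ MvPolynomial.eval x f}

/-- A set is regular if it contains an open subset of the ambient space that is dense in it. -/
def IsRegularSet {n : ℕ} (S : Set (Fin n → ℝ)) : Prop :=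
  ∃ U : Set (Fin n → ℝ), IsOpen U ∧ U ⊆ S ∧ S ⊆ closure U

/-- The tentacle `S₁`, along the curve `b = -a ^ 3 + a ^ (-2)`. -/
def lowerTentacle : Set (Fin 2 → ℝ) :=
  {x | 1 ≤ x 0 ∧ 1 ≤ x 0 ^ 3 * x 1 + x 0 ^ 6 - x 0 ∧ x 0 ^ 3 * x 1 + x 0 ^ 6 - x 0 ≤ 2}

/-- The tentacle `S₂`, along the curve `b = a ^ 3 + a ^ (-2)`. -/
def upperTentacle : Set (Fin 2 → ℝ) :=
  {x | 1 ≤ x 0 ∧ 1 ≤ x 0 ^ 3 * x 1 - x 0 ^ 6 - x 0 ∧ x 0 ^ 3 * x 1 - x 0 ^ 6 - x 0 ≤ 2}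

/-!
Along the upper tentacle use the coordinates `x = X 0` and `t = X 0 ^ 3 * X 1 - X 0 ^ 6 - X 0`, so
that `X 1 = x ^ 3 + (x + t) / x ^ 3` and a polynomial becomes an element of `ℝ[t][x, x⁻¹]`. The
reflection `(X 0, X 1) ↦ (-X 0, X 1)` takes the lower tentacle to the continuation of the upper one
to `x ≤ -1`, so a polynomial `f + X 0 * g` with `f` and `g` even in `X 0` becomes `f + x * g` on one
tentacle and `f - x * g` on the other. It is bounded on both if and only if `f` and `x * g` have no
positive powers of `x`.

The polynomial `(X 1 ^ 2 - X 0 ^ 6) / 2` becomes `x + t` to leading order in the total degree. The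
leading forms of even polynomials are spanned by the forms `(x + t) ^ l * x ^ k` with `k ≠ 1`; the
exponent `k = 1` is missing because `X 0` and `X 0 ^ 3` are odd while `X 1` already has leading form
`x ^ 3`. A positive power of `t` needs the missing form: in `t ^ N = ((x + t) - x) ^ N` the term
`(x + t) ^ (N - 1) * x` occurs. So bounded polynomials are constant. On the other hand all
`t ^ l * x ^ 2` are combinations of the available forms, and the even polynomials which realize them
up to a remainder of degree at most one in `x` lie in `GrowthModule _ 1`, since `X 0 ^ 6` is bounded
by `2 * X 1 ^ 2 + 18` on the tentacles.
-/

open scoped Polynomial LaurentPolynomial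
open LaurentPolynomial (T)
open MvPolynomial (X eval)
open Filter Topology

/-! ### Degrees and growth in `R[t][x, x⁻¹]` -/

section LaurentInXPolynomialInT

variable {R : Type*} [CommRing R]

variable (R) in
/-- The monomial `x ^ e * t ^ l` of `R[t][x, x⁻¹]`: throughout, `x` is the Laurent variable `T 1`
and `t` is the variable `Polynomial.X` of the coefficients. -/
noncomputable def xtMonomial (e : ℤ) (l : ℕ) : R[X][T;T⁻¹] :=
  LaurentPolynomial.C (Polynomial.X ^ l) * T e

variable (R) in
/-- The elements of `R[t][x, x⁻¹]` of degree at most `N` when `x` has weight `1` and `t` has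
weight `b`: this is the degree in `x` for `b = 0` and the total degree for `b = 1`. -/
noncomputable def weightedDegreeLE (b : ℕ) (N : ℤ) : Submodule R R[X][T;T⁻¹] :=
  Submodule.span R {h | ∃ (e : ℤ) (l : ℕ), e + b * l ≤ N ∧ xtMonomial R e l = h}

lemma coeff_xtMonomial (e e' : ℤ) (l : ℕ) :
    (xtMonomial R e l).coeff e' = if e = e' then Polynomial.X ^ l else 0 := by
  rw [xtMonomial, ← LaurentPolynomial.single_eq_C_mul_T, AddMonoidAlgebra.coeff_single,
    Finsupp.single_apply]

lemma xtMonomial_zero_right (e : ℤ) : xtMonomial R e 0 = T e := by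
  rw [xtMonomial, pow_zero, map_one, one_mul]

lemma xtMonomial_zero_one : xtMonomial R 0 1 = LaurentPolynomial.C Polynomial.X := by
  rw [xtMonomial, pow_one, LaurentPolynomial.T_zero, mul_one]

lemma xtMonomial_mul_xtMonomial (e e' : ℤ) (l l' : ℕ) :
    xtMonomial R e l * xtMonomial R e' l' = xtMonomial R (e + e') (l + l') := by
  rw [xtMonomial, xtMonomial, xtMonomial, pow_add, map_mul, LaurentPolynomial.T_add]
  ring

lemma xtMonomial_mem_weightedDegreeLE {b : ℕ} {N e : ℤ} {l : ℕ} (h : e + b * l ≤ N) :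
    xtMonomial R e l ∈ weightedDegreeLE R b N :=
  Submodule.subset_span ⟨e, l, h, rfl⟩

lemma T_mem_weightedDegreeLE (b : ℕ) {N e : ℤ} (h : e ≤ N) : T e ∈ weightedDegreeLE R b N := by
  rw [← xtMonomial_zero_right]
  exact xtMonomial_mem_weightedDegreeLE (by simpa using h)

lemma C_mul_T_mem_weightedDegreeLE {b : ℕ} {N e : ℤ} {g : R[X]} (h : e + b * g.natDegree ≤ N) :
    LaurentPolynomial.C g * T e ∈ weightedDegreeLE R b N := by
  have expand : LaurentPolynomial.C g * T e =
      ∑ l ∈ Finset.range (g.natDegree + 1), g.coeff l • xtMonomial R e l := by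
    conv_lhs => rw [g.as_sum_range_C_mul_X_pow, map_sum, Finset.sum_mul]
    refine Finset.sum_congr rfl fun l _ => ?_
    rw [← Polynomial.smul_eq_C_mul, ← LaurentPolynomial.single_eq_C_mul_T, xtMonomial,
      ← LaurentPolynomial.single_eq_C_mul_T, AddMonoidAlgebra.smul_single]
  rw [expand]
  refine Submodule.sum_mem _ fun l hl => Submodule.smul_mem _ _ ?_
  have hl : (l : ℤ) ≤ g.natDegree := by exact_mod_cast Finset.mem_range_succ_iff.mp hl
  exact xtMonomial_mem_weightedDegreeLE (h.trans' (by gcongr))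

lemma weightedDegreeLE_mono {b : ℕ} {M N : ℤ} (h : M ≤ N) :
    weightedDegreeLE R b M ≤ weightedDegreeLE R b N := by
  refine Submodule.span_mono ?_
  rintro _ ⟨e, l, hel, rfl⟩
  exact ⟨e, l, hel.trans h, rfl⟩

lemma mul_mem_weightedDegreeLE {b : ℕ} {M N : ℤ} {f g : R[X][T;T⁻¹]}
    (hf : f ∈ weightedDegreeLE R b M) (hg : g ∈ weightedDegreeLE R b N) :
    f * g ∈ weightedDegreeLE R b (M + N) := by
  refine (?_ : weightedDegreeLE R b M * weightedDegreeLE R b N ≤ _) (Submodule.mul_mem_mul hf hg)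
  rw [weightedDegreeLE, weightedDegreeLE, Submodule.span_mul_span, Submodule.span_le]
  rintro _ ⟨_, ⟨e, l, hel, rfl⟩, _, ⟨e', l', hel', rfl⟩, rfl⟩
  simp only [xtMonomial_mul_xtMonomial]
  refine xtMonomial_mem_weightedDegreeLE ?_
  push_cast
  linarith

lemma coeff_coeff_eq_zero_of_mem_weightedDegreeLE {b : ℕ} {N e : ℤ} {l : ℕ} {h : R[X][T;T⁻¹]}
    (hh : h ∈ weightedDegreeLE R b N) (hN : N < e + b * l) : (h.coeff e).coeff l = 0 := by
  induction hh using Submodule.span_induction with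
  | mem _ hh =>
    obtain ⟨e', l', hel, rfl⟩ := hh
    rw [coeff_xtMonomial]
    split_ifs with he
    · rw [Polynomial.coeff_X_pow, if_neg]
      rintro rfl
      exact hN.not_ge (he ▸ hel)
    · rw [Polynomial.coeff_zero]
  | zero => simp
  | add f g _ _ hf hg => rw [AddMonoidAlgebra.coeff_add, Finsupp.add_apply, Polynomial.coeff_add,
      hf, hg, add_zero]
  | smul r f _ hf => rw [AddMonoidAlgebra.coeff_smul_apply, Polynomial.coeff_smul, hf, smul_zero]

lemma mem_weightedDegreeLE_zero_iff {d : ℤ} {h : R[X][T;T⁻¹]} :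
    h ∈ weightedDegreeLE R 0 d ↔ ∀ e, d < e → h.coeff e = 0 := by
  refine ⟨fun hh e he => ?_, fun hh => ?_⟩
  · ext l
    exact coeff_coeff_eq_zero_of_mem_weightedDegreeLE hh (by simpa using he)
  · rw [← AddMonoidAlgebra.sum_coeff_single h]
    refine Submodule.sum_mem _ fun e he => ?_
    rw [LaurentPolynomial.single_eq_C_mul_T]
    refine C_mul_T_mem_weightedDegreeLE ?_
    contrapose! he
    exact Finsupp.notMem_support_iff.mpr (hh e (by simpa using he))

/-- `a'` carries the form of total degree `p` of `a`: both have total degree at most `p` and they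
agree up to terms of smaller degree. Neither is required to be homogeneous or of degree `p`. -/
def HasLeadingForm (p : ℤ) (a a' : R[X][T;T⁻¹]) : Prop :=
  a' ∈ weightedDegreeLE R 1 p ∧ a - a' ∈ weightedDegreeLE R 1 (p - 1)

namespace HasLeadingForm

variable {p q : ℤ} {a a' b b' : R[X][T;T⁻¹]}

lemma refl (ha : a ∈ weightedDegreeLE R 1 p) : HasLeadingForm p a a :=
  ⟨ha, by rw [sub_self]; exact zero_mem _⟩

lemma mem (ha : HasLeadingForm p a a') : a ∈ weightedDegreeLE R 1 p :=
  sub_add_cancel a a' ▸ add_mem (weightedDegreeLE_mono (by lia) ha.2) ha.1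

lemma sub (ha : HasLeadingForm p a a') (hb : HasLeadingForm p b b') :
    HasLeadingForm p (a - b) (a' - b') :=
  ⟨sub_mem ha.1 hb.1, by simpa only [sub_sub_sub_comm] using sub_mem ha.2 hb.2⟩

lemma mul (ha : HasLeadingForm p a a') (hb : HasLeadingForm q b b') :
    HasLeadingForm (p + q) (a * b) (a' * b') := by
  refine ⟨mul_mem_weightedDegreeLE ha.1 hb.1, ?_⟩
  have split : a * b - a' * b' = (a - a') * (b - b') + (a - a') * b' + a' * (b - b') := by ring
  rw [split]
  refine add_mem (add_mem ?_ ?_) ?_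
  · exact weightedDegreeLE_mono (by lia) (mul_mem_weightedDegreeLE ha.2 hb.2)
  · exact weightedDegreeLE_mono (by lia) (mul_mem_weightedDegreeLE ha.2 hb.1)
  · exact weightedDegreeLE_mono (by lia) (mul_mem_weightedDegreeLE ha.1 hb.2)

lemma pow (ha : HasLeadingForm p a a') (n : ℕ) : HasLeadingForm (n * p) (a ^ n) (a' ^ n) := by
  induction n with
  | zero =>
    rw [pow_zero, pow_zero]
    exact refl (LaurentPolynomial.T_zero (R := R[X]) ▸ T_mem_weightedDegreeLE 1 (by simp))
  | succ n ih =>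
    rw [pow_succ, pow_succ, Nat.cast_succ, add_one_mul]
    exact ih.mul ha

end HasLeadingForm

/-- Evaluation of `R[t][x, x⁻¹]` at given values of `x` and `t`. -/
noncomputable def curveEval (x : Rˣ) (t : R) : R[X][T;T⁻¹] →ₐ[R] R where
  __ := LaurentPolynomial.eval₂ (Polynomial.evalRingHom t) x
  commutes' r := by
    simp [LaurentPolynomial.algebraMap_apply]

lemma curveEval_xtMonomial (x : Rˣ) (t : R) (e : ℤ) (l : ℕ) :
    curveEval x t (xtMonomial R e l) = (x ^ e : Rˣ) * t ^ l := by
  change LaurentPolynomial.eval₂ (Polynomial.evalRingHom t) x _ = _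
  rw [xtMonomial, LaurentPolynomial.eval₂_C_mul_T, mul_comm]
  simp

lemma curveEval_T (x : Rˣ) (t : R) (e : ℤ) : curveEval x t (T e) = (x ^ e : Rˣ) := by
  rw [← xtMonomial_zero_right, curveEval_xtMonomial, pow_zero, mul_one]

end LaurentInXPolynomialInT

section Growth

variable {𝕜 : Type*} [NormedField 𝕜]

lemma exists_forall_norm_curveEval_le {d : ℕ} {h : 𝕜[X][T;T⁻¹]} (hh : h ∈ weightedDegreeLE 𝕜 0 d)
    (r : ℝ) : ∃ K : ℝ, ∀ (x : 𝕜ˣ) (t : 𝕜), 1 ≤ ‖(x : 𝕜)‖ → ‖t‖ ≤ r →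
      ‖curveEval x t h‖ ≤ K * ‖(x : 𝕜)‖ ^ d := by
  induction hh using Submodule.span_induction with
  | mem _ hh =>
    obtain ⟨e, l, hel, rfl⟩ := hh
    refine ⟨r ^ l, fun x t hx ht => ?_⟩
    have he : e ≤ d := by simpa using hel
    rw [curveEval_xtMonomial, norm_mul, norm_pow, Units.val_zpow_eq_zpow_val, norm_zpow, mul_comm,
      ← zpow_natCast ‖(x : 𝕜)‖]
    have := (norm_nonneg t).trans ht
    gcongr
  | zero => exact ⟨0, fun x t _ _ => by simp⟩
  | add f g _ _ hf hg =>
    obtain ⟨K, hK⟩ := hf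
    obtain ⟨K', hK'⟩ := hg
    refine ⟨K + K', fun x t hx ht => ?_⟩
    rw [map_add, add_mul]
    exact (norm_add_le _ _).trans (add_le_add (hK x t hx ht) (hK' x t hx ht))
  | smul c f _ hf =>
    obtain ⟨K, hK⟩ := hf
    refine ⟨‖c‖ * K, fun x t hx ht => ?_⟩
    rw [map_smul, norm_smul, mul_assoc]
    exact mul_le_mul_of_nonneg_left (hK x t hx ht) (norm_nonneg c)

variable {ι : Type*} {l : Filter ι} {u : ι → 𝕜ˣ}

lemma tendsto_zpow_neg_mul_curveEval (hu : Tendsto (fun i => ‖(u i : 𝕜)‖) l atTop) {d : ℤ}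
    {h : 𝕜[X][T;T⁻¹]} (hh : h ∈ weightedDegreeLE 𝕜 0 d) (t : 𝕜) :
    Tendsto (fun i => (u i : 𝕜) ^ (-d) * curveEval (u i) t h) l (𝓝 ((h.coeff d).eval t)) := by
  induction hh using Submodule.span_induction with
  | mem _ hh =>
    obtain ⟨e, m, hem, rfl⟩ := hh
    have collect : ∀ i, (u i : 𝕜) ^ (-d) * curveEval (u i) t (xtMonomial 𝕜 e m) =
        (u i : 𝕜) ^ (e - d) * t ^ m := fun i => by
      rw [curveEval_xtMonomial, Units.val_zpow_eq_zpow_val, ← mul_assoc,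
        ← zpow_add₀ (u i).ne_zero, neg_add_eq_sub]
    simp only [collect, coeff_xtMonomial]
    have he : e ≤ d := by simpa using hem
    rcases he.eq_or_lt with rfl | he
    · simpa using tendsto_const_nhds
    · rw [if_neg he.ne, Polynomial.eval_zero, ← zero_mul (t ^ m)]
      refine Tendsto.mul_const _ (tendsto_zero_iff_norm_tendsto_zero.mpr ?_)
      simp only [norm_zpow]
      exact (tendsto_zpow_atTop_zero (sub_neg.mpr he)).comp hu
  | zero => simpa using tendsto_const_nhds
  | add f g _ _ hf hg => simpa [mul_add] using hf.add hg
  | smul c f _ hf => simpa [mul_left_comm] using hf.const_mul c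

lemma mem_weightedDegreeLE_zero_of_bounded [l.NeBot]
    (hu : Tendsto (fun i => ‖(u i : 𝕜)‖) l atTop) {B : Set 𝕜} (hB : B.Infinite) {K : ℝ}
    {h : 𝕜[X][T;T⁻¹]} (hK : ∀ i, ∀ t ∈ B, ‖curveEval (u i) t h‖ ≤ K) :
    h ∈ weightedDegreeLE 𝕜 0 0 := by
  rw [mem_weightedDegreeLE_zero_iff]
  by_contra! ⟨e, he, hne⟩
  have hsupp : h.coeff.support.Nonempty := ⟨e, Finsupp.mem_support_iff.mpr hne⟩
  set d := h.coeff.support.max' hsupp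
  have hd : 0 < d := he.trans_le (Finset.le_max' _ _ (Finsupp.mem_support_iff.mpr hne))
  have hdeg : h ∈ weightedDegreeLE 𝕜 0 d := mem_weightedDegreeLE_zero_iff.mpr fun e' he' =>
    Finsupp.notMem_support_iff.mp fun hmem => (Finset.le_max' _ _ hmem).not_gt he'
  refine Finsupp.mem_support_iff.mp (Finset.max'_mem _ hsupp) ?_
  refine Polynomial.eq_zero_of_infinite_isRoot _ (hB.mono fun t ht => ?_)
  refine tendsto_nhds_unique (tendsto_zpow_neg_mul_curveEval hu hdeg t) ?_
  have hpow : Tendsto (fun i => (u i : 𝕜) ^ (-d)) l (𝓝 0) := by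
    refine tendsto_zero_iff_norm_tendsto_zero.mpr ?_
    simp only [norm_zpow]
    exact (tendsto_zpow_atTop_zero (neg_neg_of_pos hd)).comp hu
  exact hpow.zero_mul_isBoundedUnder_le (isBoundedUnder_of ⟨K, fun i => hK i t ht⟩)

end Growth

/-! ### Leading forms of even polynomials -/

/-- The element `x + t`: the value of `X 0 ^ 3 * X 1 - X 0 ^ 6` on the curve parametrized by
`toCurve`. -/
noncomputable def xAddT : ℝ[X][T;T⁻¹] := T 1 + LaurentPolynomial.C Polynomial.X

/-- The substitution `X 0 = x`, `X 1 = x ^ 3 + (x + t) / x ^ 3`, which parametrizes the curve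
`X 0 ^ 3 * X 1 - X 0 ^ 6 - X 0 = t` by `x`. -/
noncomputable def toCurve : MvPolynomial (Fin 2) ℝ →ₐ[ℝ] ℝ[X][T;T⁻¹] :=
  MvPolynomial.aeval ![T 1, T 3 + xAddT * T (-3)]

/-- Half the difference of `X 1 ^ 2` and `X 0 ^ 6`: along the curves parametrized by `toCurve` the
terms of degree `6` cancel, and `x + t` is what remains to leading order. -/
noncomputable def halfDiff : MvPolynomial (Fin 2) ℝ :=
  MvPolynomial.C (1 / 2) * (X 1 ^ 2 - X 0 ^ 6)

/-- The polynomials which are even in the variable `X 0`. -/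
noncomputable def evenPolynomials : Subalgebra ℝ (MvPolynomial (Fin 2) ℝ) where
  carrier := {f | ∀ x y, eval ![-x, y] f = eval ![x, y] f}
  mul_mem' hf hg x y := by rw [map_mul, map_mul, hf, hg]
  add_mem' hf hg x y := by rw [map_add, map_add, hf, hg]
  algebraMap_mem' r x y := by simp [MvPolynomial.algebraMap_eq]

/-- For `k ≠ 1`, the even polynomial with leading form `(x + t) ^ l * x ^ k`. The form `x` itself is
not reached: for `k = 1` the truncated subtraction makes the exponent of `X 0` meaningless. -/
noncomputable def evenMonomial (l k : ℕ) : MvPolynomial (Fin 2) ℝ :=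
  halfDiff ^ l * X 0 ^ (k - 3 * (k % 2)) * X 1 ^ (k % 2)

/-- The span of the polynomials `evenMonomial l k` whose leading forms have degree at most `N`. -/
noncomputable def evenSpan (N : ℕ) : Submodule ℝ (MvPolynomial (Fin 2) ℝ) :=
  Submodule.span ℝ {m | ∃ l k, k ≠ 1 ∧ l + k ≤ N ∧ evenMonomial l k = m}

lemma coeff_toLaurent_natCast {R : Type*} [Semiring R] (p : R[X]) (e : ℕ) :
    (Polynomial.toLaurent p).coeff (e : ℤ) = p.coeff e := by
  rw [LaurentPolynomial.coeff_toLaurent]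
  exact Finsupp.mapDomain_apply Nat.castEmbedding.injective _ e

lemma xAddT_mem_weightedDegreeLE : xAddT ∈ weightedDegreeLE ℝ 1 1 := by
  rw [xAddT, ← xtMonomial_zero_one]
  exact add_mem (T_mem_weightedDegreeLE 1 le_rfl) (xtMonomial_mem_weightedDegreeLE le_rfl)

lemma coeff_xAddT_pow_mul_T (n k e : ℕ) : (xAddT ^ n * T k).coeff e =
    if k ≤ e then Polynomial.X ^ (n - (e - k)) * (n.choose (e - k) : ℝ[X]) else 0 := by
  have toLaurent_eq : xAddT ^ n * T k = Polynomial.toLaurent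
      ((Polynomial.X + Polynomial.C Polynomial.X) ^ n * Polynomial.X ^ k) := by
    rw [map_mul, map_pow, map_add, Polynomial.toLaurent_X, Polynomial.toLaurent_C,
      Polynomial.toLaurent_X_pow, xAddT]
  rw [toLaurent_eq, coeff_toLaurent_natCast, Polynomial.coeff_mul_X_pow',
    Polynomial.coeff_X_add_C_pow]

lemma toCurve_X_zero : toCurve (X 0) = T 1 := by
  simp [toCurve]

lemma toCurve_X_one : toCurve (X 1) = T 3 + xAddT * T (-3) := by
  simp [toCurve]

lemma toCurve_halfDiff :
    toCurve halfDiff = xAddT + LaurentPolynomial.C (Polynomial.C (1 / 2)) * xAddT ^ 2 * T (-6) := by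
  have half_mul_two : LaurentPolynomial.C (Polynomial.C (1 / 2 : ℝ)) * 2 = 1 := by
    rw [← map_ofNat LaurentPolynomial.C 2, ← map_ofNat Polynomial.C 2, ← map_mul, ← map_mul]
    norm_num
  have T_three_mul : (T 3 * T (-3) : ℝ[X][T;T⁻¹]) = 1 := by
    rw [← LaurentPolynomial.T_add, add_neg_cancel, LaurentPolynomial.T_zero]
  have T_three_sq : (T 3 ^ 2 : ℝ[X][T;T⁻¹]) = T 1 ^ 6 := by
    rw [LaurentPolynomial.T_pow, LaurentPolynomial.T_pow]
    norm_num
  have T_neg_three_sq : (T (-3) ^ 2 : ℝ[X][T;T⁻¹]) = T (-6) := by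
    rw [LaurentPolynomial.T_pow]
    norm_num
  have toCurve_C (r : ℝ) :
      toCurve (MvPolynomial.C r) = LaurentPolynomial.C (Polynomial.C r) :=
    toCurve.commutes r
  rw [halfDiff, map_mul, map_sub, map_pow, map_pow, toCurve_X_zero, toCurve_X_one, toCurve_C]
  linear_combination xAddT * half_mul_two + LaurentPolynomial.C (Polynomial.C (1 / 2)) *
    (T_three_sq + 2 * xAddT * T_three_mul + xAddT ^ 2 * T_neg_three_sq)

lemma hasLeadingForm_X_zero : HasLeadingForm 1 (toCurve (X 0)) (T 1) := by
  rw [toCurve_X_zero]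
  exact .refl (T_mem_weightedDegreeLE 1 le_rfl)

lemma hasLeadingForm_X_one : HasLeadingForm 3 (toCurve (X 1)) (T 3) := by
  refine ⟨T_mem_weightedDegreeLE 1 le_rfl, ?_⟩
  rw [toCurve_X_one, add_sub_cancel_left]
  exact weightedDegreeLE_mono (by norm_num)
    (mul_mem_weightedDegreeLE xAddT_mem_weightedDegreeLE (T_mem_weightedDegreeLE 1 le_rfl))

lemma hasLeadingForm_halfDiff : HasLeadingForm 1 (toCurve halfDiff) xAddT := by
  refine ⟨xAddT_mem_weightedDegreeLE, ?_⟩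
  rw [toCurve_halfDiff, add_sub_cancel_left, mul_assoc, ← Polynomial.algebraMap_eq,
    ← LaurentPolynomial.algebraMap_apply, ← Algebra.smul_def, sq]
  exact Submodule.smul_mem _ _ <| weightedDegreeLE_mono (by norm_num)
    (mul_mem_weightedDegreeLE
      (mul_mem_weightedDegreeLE xAddT_mem_weightedDegreeLE xAddT_mem_weightedDegreeLE)
      (T_mem_weightedDegreeLE 1 le_rfl))

lemma hasLeadingForm_evenMonomial (l : ℕ) {k : ℕ} (hk : k ≠ 1) :
    HasLeadingForm ((l + k : ℕ) : ℤ) (toCurve (evenMonomial l k)) (xAddT ^ l * T k) := by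
  have hk : (k - 3 * (k % 2)) + 3 * (k % 2) = k := by lia
  have h := ((hasLeadingForm_halfDiff.pow l).mul
    (hasLeadingForm_X_zero.pow (k - 3 * (k % 2)))).mul (hasLeadingForm_X_one.pow (k % 2))
  rw [← map_pow, ← map_pow, ← map_pow, ← map_mul, ← map_mul, LaurentPolynomial.T_pow,
    LaurentPolynomial.T_pow, mul_assoc (xAddT ^ l), ← LaurentPolynomial.T_add] at h
  rw [evenMonomial]
  convert h using 3 <;> lia

lemma X_zero_pow_mem_evenPolynomials {n : ℕ} (hn : Even n) :
    X 0 ^ n ∈ evenPolynomials := fun x y => by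
  simp [hn.neg_pow]

lemma X_one_mem_evenPolynomials : X 1 ∈ evenPolynomials := fun x y => by
  simp

lemma halfDiff_mem_evenPolynomials : halfDiff ∈ evenPolynomials :=
  mul_mem (evenPolynomials.algebraMap_mem _)
    (sub_mem (pow_mem X_one_mem_evenPolynomials 2) (X_zero_pow_mem_evenPolynomials (by decide)))

lemma evenMonomial_mem_evenPolynomials (l k : ℕ) : evenMonomial l k ∈ evenPolynomials :=
  mul_mem (mul_mem (pow_mem halfDiff_mem_evenPolynomials l)
    (X_zero_pow_mem_evenPolynomials (Nat.even_iff.mpr (by lia))))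
    (pow_mem X_one_mem_evenPolynomials _)

lemma exists_hasLeadingForm_xtMonomial {e : ℕ} (he : 2 ≤ e) (l : ℕ) :
    ∃ f ∈ evenPolynomials, HasLeadingForm (e + l) (toCurve f) (xtMonomial ℝ e l) := by
  induction l generalizing e with
  | zero =>
    refine ⟨evenMonomial 0 e, evenMonomial_mem_evenPolynomials 0 e, ?_⟩
    simpa [xtMonomial_zero_right] using hasLeadingForm_evenMonomial 0 (show e ≠ 1 by lia)
  | succ l ih =>
    obtain ⟨f, hf, hfe⟩ := ih he
    obtain ⟨g, hg, hge⟩ := ih (he.trans e.le_succ)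
    refine ⟨halfDiff * f - g, sub_mem (mul_mem halfDiff_mem_evenPolynomials hf) hg, ?_⟩
    have isolate : xtMonomial ℝ e (l + 1) =
        xAddT * xtMonomial ℝ e l - xtMonomial ℝ (e + 1 : ℕ) l := by
      rw [xAddT, ← xtMonomial_zero_one, ← xtMonomial_zero_right, add_mul,
        xtMonomial_mul_xtMonomial, xtMonomial_mul_xtMonomial, Nat.cast_succ, zero_add, zero_add,
        add_comm 1, add_comm 1, add_sub_cancel_left]
    rw [isolate, map_sub, map_mul]
    have degree_eq : ((e + (l + 1 : ℕ) : ℤ)) = 1 + (e + l) := by lia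
    have degree_eq' : ((e + (l + 1 : ℕ) : ℤ)) = (e + 1 : ℕ) + l := by lia
    exact (degree_eq ▸ hasLeadingForm_halfDiff.mul hfe).sub (degree_eq' ▸ hge)

lemma weightedDegreeLE_one_le_map_evenPolynomials_sup (N : ℕ) :
    weightedDegreeLE ℝ 1 N ≤
      evenPolynomials.toSubmodule.map toCurve.toLinearMap ⊔ weightedDegreeLE ℝ 0 1 := by
  induction N using Nat.strong_induction_on with
  | _ N ih =>
    refine Submodule.span_le.mpr ?_
    rintro _ ⟨e, l, hel, rfl⟩
    rcases le_or_gt e 1 with he | he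
    · exact Submodule.mem_sup_right (xtMonomial_mem_weightedDegreeLE (by simpa using he))
    · lift e to ℕ using by lia
      obtain ⟨f, hf, hfe⟩ := exists_hasLeadingForm_xtMonomial (show 2 ≤ e by lia) l
      have rest := ih (e + l - 1) (by lia) (weightedDegreeLE_mono (by lia) hfe.2)
      simpa using sub_mem (Submodule.mem_sup_left (Submodule.mem_map_of_mem hf)) rest

lemma evenMonomial_zero_zero : evenMonomial 0 0 = 1 := by
  simp [evenMonomial]

lemma evenMonomial_mem_evenSpan {l k N : ℕ} (hk : k ≠ 1) (h : l + k ≤ N) :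
    evenMonomial l k ∈ evenSpan N :=
  Submodule.subset_span ⟨l, k, hk, h, rfl⟩

lemma evenSpan_mono {M N : ℕ} (h : M ≤ N) : evenSpan M ≤ evenSpan N := by
  refine Submodule.span_mono ?_
  rintro _ ⟨l, k, hk, hlk, rfl⟩
  exact ⟨l, k, hk, hlk.trans h, rfl⟩

lemma evenSpan_le_evenPolynomials (N : ℕ) : evenSpan N ≤ evenPolynomials.toSubmodule := by
  refine Submodule.span_le.mpr ?_
  rintro _ ⟨l, k, -, -, rfl⟩
  exact evenMonomial_mem_evenPolynomials l k

lemma toCurve_mem_weightedDegreeLE {N : ℕ} {f : MvPolynomial (Fin 2) ℝ} (hf : f ∈ evenSpan N) :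
    toCurve f ∈ weightedDegreeLE ℝ 1 N := by
  refine (?_ : evenSpan N ≤ (weightedDegreeLE ℝ 1 N).comap toCurve.toLinearMap) hf
  refine Submodule.span_le.mpr ?_
  rintro _ ⟨l, k, hk, hlk, rfl⟩
  exact weightedDegreeLE_mono (by exact_mod_cast hlk) (hasLeadingForm_evenMonomial l hk).mem

lemma X_zero_sq_mul_evenMonomial (l : ℕ) {k : ℕ} (hk : k ≠ 1) :
    X 0 ^ 2 * evenMonomial l k = evenMonomial l (k + 2) := by
  have hexp : k + 2 - 3 * ((k + 2) % 2) = 2 + (k - 3 * (k % 2)) := by lia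
  rw [evenMonomial, evenMonomial, hexp, Nat.add_mod_right, pow_add]
  ring

lemma evenMonomial_two_mul (l m : ℕ) :
    evenMonomial l (2 * m) = halfDiff ^ l * X 0 ^ (2 * m) := by
  simp [evenMonomial]

lemma evenMonomial_two_mul_add_three (l m : ℕ) :
    evenMonomial l (2 * m + 3) = halfDiff ^ l * X 0 ^ (2 * m) * X 1 := by
  have hmod : (2 * m + 3) % 2 = 1 := by lia
  simp [evenMonomial, hmod]

lemma X_one_mul_evenMonomial_two_mul (l m : ℕ) :
    X 1 * evenMonomial l (2 * m) = evenMonomial l (2 * m + 3) := by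
  rw [evenMonomial_two_mul, evenMonomial_two_mul_add_three, mul_comm]

lemma X_one_sq : (X 1 ^ 2 : MvPolynomial (Fin 2) ℝ) = (2 : ℝ) • halfDiff + X 0 ^ 6 := by
  rw [halfDiff, MvPolynomial.smul_eq_C_mul, ← mul_assoc, ← map_mul]
  norm_num

lemma X_one_mul_evenMonomial_two_mul_add_three (l m : ℕ) :
    X 1 * evenMonomial l (2 * m + 3) =
      (2 : ℝ) • evenMonomial (l + 1) (2 * m) + evenMonomial l (2 * (m + 3)) := by
  rw [evenMonomial_two_mul, evenMonomial_two_mul, evenMonomial_two_mul_add_three]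
  simp only [MvPolynomial.smul_eq_C_mul]
  linear_combination (halfDiff ^ l * X 0 ^ (2 * m)) *
    (X_one_sq.trans (by rw [MvPolynomial.smul_eq_C_mul]))

lemma X_zero_sq_mul_mem_evenSpan {N : ℕ} {f : MvPolynomial (Fin 2) ℝ} (hf : f ∈ evenSpan N) :
    X 0 ^ 2 * f ∈ evenSpan (N + 2) := by
  refine (?_ : evenSpan N ≤ (evenSpan (N + 2)).comap (LinearMap.mulLeft ℝ (X 0 ^ 2))) hf
  refine Submodule.span_le.mpr ?_
  rintro _ ⟨l, k, hk, hlk, rfl⟩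
  simp only [SetLike.mem_coe, Submodule.mem_comap, LinearMap.mulLeft_apply,
    X_zero_sq_mul_evenMonomial l hk]
  exact evenMonomial_mem_evenSpan (by lia) (by lia)

lemma X_one_mul_mem_evenSpan {N : ℕ} {f : MvPolynomial (Fin 2) ℝ} (hf : f ∈ evenSpan N) :
    X 1 * f ∈ evenSpan (N + 3) := by
  refine (?_ : evenSpan N ≤ (evenSpan (N + 3)).comap (LinearMap.mulLeft ℝ (X 1))) hf
  refine Submodule.span_le.mpr ?_
  rintro _ ⟨l, k, hk, hlk, rfl⟩
  simp only [SetLike.mem_coe, Submodule.mem_comap, LinearMap.mulLeft_apply]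
  obtain ⟨m, rfl | rfl⟩ : ∃ m, k = 2 * m ∨ k = 2 * m + 3 := ⟨k / 2 - k % 2, by lia⟩
  · rw [X_one_mul_evenMonomial_two_mul]
    exact evenMonomial_mem_evenSpan (by lia) (by lia)
  · rw [X_one_mul_evenMonomial_two_mul_add_three]
    exact add_mem (Submodule.smul_mem _ _ (evenMonomial_mem_evenSpan (by lia) (by lia)))
      (evenMonomial_mem_evenSpan (by lia) (by lia))

lemma exists_eq_add_X_zero_mul (p : MvPolynomial (Fin 2) ℝ) :
    ∃ N, ∃ f ∈ evenSpan N, ∃ g ∈ evenSpan N, p = f + X 0 * g := by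
  induction p using MvPolynomial.induction_on with
  | C r =>
    refine ⟨0, r • evenMonomial 0 0, ?_, 0, zero_mem _, by
      simp [evenMonomial_zero_zero, MvPolynomial.smul_eq_C_mul]⟩
    exact Submodule.smul_mem _ _ (evenMonomial_mem_evenSpan zero_ne_one le_rfl)
  | add p p' hp hp' =>
    obtain ⟨N, f, hf, g, hg, rfl⟩ := hp
    obtain ⟨N', f', hf', g', hg', rfl⟩ := hp'
    have hN := evenSpan_mono (le_max_left N N')
    have hN' := evenSpan_mono (le_max_right N N')
    exact ⟨max N N', f + f', add_mem (hN hf) (hN' hf'), g + g', add_mem (hN hg) (hN' hg'),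
      by ring⟩
  | mul_X p i hp =>
    obtain ⟨N, f, hf, g, hg, rfl⟩ := hp
    fin_cases i
    · exact ⟨N + 2, X 0 ^ 2 * g, X_zero_sq_mul_mem_evenSpan hg, f, evenSpan_mono (by lia) hf,
        by simp only [Fin.zero_eta]; ring⟩
    · exact ⟨N + 3, X 1 * f, X_one_mul_mem_evenSpan hf, X 1 * g, X_one_mul_mem_evenSpan hg,
        by simp only [Fin.mk_one]; ring⟩

lemma exists_sub_sum_mem_evenSpan {N : ℕ} {f : MvPolynomial (Fin 2) ℝ}
    (hf : f ∈ evenSpan (N + 1)) : ∃ c : ℕ → ℝ, c 1 = 0 ∧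
      f - ∑ k ∈ Finset.range (N + 2), c k • evenMonomial (N + 1 - k) k ∈ evenSpan N := by
  induction hf using Submodule.span_induction with
  | mem _ hf =>
    obtain ⟨l, k, hk, hlk, rfl⟩ := hf
    rcases hlk.eq_or_lt with hlk | hlk
    · refine ⟨Pi.single k 1, Pi.single_eq_of_ne hk.symm 1, ?_⟩
      rw [Finset.sum_eq_single_of_mem k (Finset.mem_range.mpr (by lia))
        fun j _ hj => by rw [Pi.single_eq_of_ne hj, zero_smul], Pi.single_eq_same, one_smul,
        ← hlk, Nat.add_sub_cancel, sub_self]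
      exact zero_mem _
    · exact ⟨0, rfl, by simpa using evenMonomial_mem_evenSpan hk (Nat.lt_succ_iff.mp hlk)⟩
  | zero => exact ⟨0, rfl, by simp⟩
  | add f g _ _ hf hg =>
    obtain ⟨c, hc, hf⟩ := hf
    obtain ⟨c', hc', hg⟩ := hg
    refine ⟨c + c', by rw [Pi.add_apply, hc, hc', add_zero], ?_⟩
    simpa only [Pi.add_apply, add_smul, Finset.sum_add_distrib, add_sub_add_comm]
      using add_mem hf hg
  | smul r f _ hf =>
    obtain ⟨c, hc, hf⟩ := hf
    refine ⟨r • c, by rw [Pi.smul_apply, hc, smul_zero], ?_⟩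
    simpa only [Pi.smul_apply, smul_assoc, ← Finset.smul_sum, ← smul_sub]
      using Submodule.smul_mem _ r hf

lemma toCurve_sub_sum_mem_weightedDegreeLE {N : ℕ} {f : MvPolynomial (Fin 2) ℝ} {c : ℕ → ℝ}
    (hc : c 1 = 0)
    (hf : f - ∑ k ∈ Finset.range (N + 2), c k • evenMonomial (N + 1 - k) k ∈ evenSpan N) :
    toCurve f - ∑ k ∈ Finset.range (N + 2), c k • (xAddT ^ (N + 1 - k) * T k) ∈
      weightedDegreeLE ℝ 1 N := by
  have split : toCurve f - ∑ k ∈ Finset.range (N + 2), c k • (xAddT ^ (N + 1 - k) * T k) =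
      toCurve (f - ∑ k ∈ Finset.range (N + 2), c k • evenMonomial (N + 1 - k) k) +
        ∑ k ∈ Finset.range (N + 2),
          c k • (toCurve (evenMonomial (N + 1 - k) k) - xAddT ^ (N + 1 - k) * T k) := by
    simp only [map_sub, map_sum, map_smul, smul_sub, Finset.sum_sub_distrib]
    abel
  rw [split]
  refine add_mem (toCurve_mem_weightedDegreeLE hf) (sum_mem fun k hk => ?_)
  rcases eq_or_ne k 1 with rfl | hk1
  · rw [hc, zero_smul]
    exact zero_mem _
  · have hk := Finset.mem_range.mp hk
    exact Submodule.smul_mem _ _ <|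
      weightedDegreeLE_mono (by lia) (hasLeadingForm_evenMonomial (N + 1 - k) hk1).2

lemma coeff_coeff_sum_xAddT_pow_mul_T (c : ℕ → ℝ) {M e : ℕ} (he : e ≤ M) :
    ((∑ k ∈ Finset.range (M + 1), c k • (xAddT ^ (M - k) * T k)).coeff e).coeff (M - e) =
      ∑ k ∈ Finset.range (M + 1), if k ≤ e then c k * (M - k).choose (e - k) else 0 := by
  rw [AddMonoidAlgebra.coeff_sum, Finsupp.finsetSum_apply, Polynomial.finsetSum_coeff]
  refine Finset.sum_congr rfl fun k _ => ?_
  rw [AddMonoidAlgebra.coeff_smul_apply, Polynomial.coeff_smul, coeff_xAddT_pow_mul_T]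
  split_ifs with hke
  · rw [show M - k - (e - k) = M - e by lia, ← map_natCast Polynomial.C, Polynomial.coeff_mul_C,
      Polynomial.coeff_X_pow_self, one_mul, smul_eq_mul]
  · rw [Polynomial.coeff_zero, smul_zero]

/- A form `∑ c k * (x + t) ^ (M - k) * x ^ k` all of whose terms have degree at most zero in `x` is
a multiple of `t ^ M = ((x + t) - x) ^ M`, which does contain `(x + t) ^ (M - 1) * x`. -/
lemma eq_zero_of_sum_choose_eq_zero {M : ℕ} (hM : 0 < M) {c : ℕ → ℝ} (hc : c 1 = 0)
    (h : ∀ e, 0 < e → e ≤ M →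
      ∑ k ∈ Finset.range (M + 1), (if k ≤ e then c k * (M - k).choose (e - k) else 0) = 0) :
    ∀ k ≤ M, c k = 0 := by
  intro k
  induction k using Nat.strong_induction_on with
  | _ k ih =>
    intro hk
    have hsum := h (max k 1) (by lia) (by lia)
    rw [Finset.sum_eq_single_of_mem k (Finset.mem_range_succ_iff.mpr hk), if_pos (le_max_left k 1)]
      at hsum
    · refine (mul_eq_zero.mp hsum).resolve_right (Nat.cast_ne_zero.mpr ?_)
      exact (Nat.choose_pos (by lia)).ne'
    · intro j _ hj
      split_ifs with hjk
      · rcases hj.lt_or_gt with hj | hj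
        · rw [ih j hj (by lia), zero_mul]
        · rw [show j = 1 by lia, hc, zero_mul]
      · rfl

theorem exists_C_eq_of_mem_evenSpan {N : ℕ} {f : MvPolynomial (Fin 2) ℝ} (hf : f ∈ evenSpan N)
    (hbdd : toCurve f ∈ weightedDegreeLE ℝ 0 0) : ∃ r, MvPolynomial.C r = f := by
  induction N generalizing f with
  | zero =>
    have generated_by_one : evenSpan 0 ≤ (⊥ : Subalgebra ℝ _).toSubmodule := by
      refine Submodule.span_le.mpr ?_
      rintro _ ⟨l, k, -, hlk, rfl⟩
      obtain ⟨rfl, rfl⟩ : l = 0 ∧ k = 0 := by lia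
      rw [evenMonomial_zero_zero]
      exact one_mem (⊥ : Subalgebra ℝ (MvPolynomial (Fin 2) ℝ))
    exact Algebra.mem_bot.mp (generated_by_one hf)
  | succ N ih =>
    obtain ⟨c, hc, hg⟩ := exists_sub_sum_mem_evenSpan hf
    have hlead := toCurve_sub_sum_mem_weightedDegreeLE hc hg
    have hzero : ∀ k ≤ N + 1, c k = 0 := by
      refine eq_zero_of_sum_choose_eq_zero N.succ_pos hc fun e he heN => ?_
      rw [← coeff_coeff_sum_xAddT_pow_mul_T c heN]
      have hdiff := coeff_coeff_eq_zero_of_mem_weightedDegreeLE (e := e) (l := N + 1 - e) hlead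
        (by lia)
      rwa [AddMonoidAlgebra.coeff_sub, Finsupp.sub_apply, Polynomial.coeff_sub,
        mem_weightedDegreeLE_zero_iff.mp hbdd e (by exact_mod_cast he), Polynomial.coeff_zero,
        zero_sub, neg_eq_zero] at hdiff
    rw [Finset.sum_eq_zero fun k hk => by
      rw [hzero k (Finset.mem_range_succ_iff.mp hk), zero_smul], sub_zero] at hg
    exact ih hg hbdd

/-! ### The geometry of the tentacles -/

/-- The planar set `{(a, b) | a ∈ A, a ^ 3 * b - c * a ^ 6 - a ∈ B}`: the upper tentacle has
`c = 1` and the lower one `c = -1`. -/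
def tentacle (c : ℝ) (A B : Set ℝ) : Set (Fin 2 → ℝ) :=
  {p | p 0 ∈ A ∧ p 0 ^ 3 * p 1 - c * p 0 ^ 6 - p 0 ∈ B}

/-- The solution `(a, b)` of `a ^ 3 * b - c * a ^ 6 - a = τ`, as a function of `(a, τ)`. -/
noncomputable def tentaclePoint (c : ℝ) (p : ℝ × ℝ) : Fin 2 → ℝ :=
  ![p.1, c * p.1 ^ 3 + (p.1 + p.2) / p.1 ^ 3]

lemma upperTentacle_eq : upperTentacle = tentacle 1 (Set.Ici 1) (Set.Icc 1 2) := by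
  simp [upperTentacle, tentacle]

lemma lowerTentacle_eq : lowerTentacle = tentacle (-1) (Set.Ici 1) (Set.Icc 1 2) := by
  simp [lowerTentacle, tentacle]

lemma tentaclePoint_mem_tentacle {c a τ : ℝ} {A B : Set ℝ} (ha : a ≠ 0) (haA : a ∈ A)
    (hτ : τ ∈ B) : tentaclePoint c (a, τ) ∈ tentacle c A B := by
  refine ⟨haA, ?_⟩
  convert hτ
  simp only [tentaclePoint, Matrix.cons_val_zero, Matrix.cons_val_one, Matrix.cons_val_fin_one]
  field_simp
  ring

lemma exists_eq_tentaclePoint {c : ℝ} {A B : Set ℝ} {p : Fin 2 → ℝ} (hp : p ∈ tentacle c A B)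
    (h0 : p 0 ≠ 0) : ∃ a ∈ A, ∃ τ ∈ B, tentaclePoint c (a, τ) = p := by
  refine ⟨p 0, hp.1, _, hp.2, ?_⟩
  ext i
  fin_cases i
  · rfl
  · simp only [tentaclePoint, Fin.mk_one, Matrix.cons_val_one, Matrix.cons_val_fin_one]
    field_simp
    ring

lemma tentacle_eq_image (c : ℝ) {A : Set ℝ} (hA : 0 ∉ A) (B : Set ℝ) :
    tentacle c A B = tentaclePoint c '' (A ×ˢ B) := by
  ext p
  constructor
  · intro hp
    obtain ⟨a, ha, τ, hτ, rfl⟩ := exists_eq_tentaclePoint hp fun h0 => hA (h0 ▸ hp.1)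
    exact ⟨(a, τ), ⟨ha, hτ⟩, rfl⟩
  · rintro ⟨⟨a, τ⟩, ⟨ha, hτ⟩, rfl⟩
    exact tentaclePoint_mem_tentacle (ne_of_mem_of_not_mem ha hA) ha hτ

lemma isOpen_tentacle (c : ℝ) {A B : Set ℝ} (hA : IsOpen A) (hB : IsOpen B) :
    IsOpen (tentacle c A B) :=
  (hA.preimage (continuous_apply 0)).inter (hB.preimage (by fun_prop))

lemma tentacle_closure_subset (c : ℝ) {A : Set ℝ} (hA : 0 ∉ closure A) (B : Set ℝ) :
    tentacle c (closure A) (closure B) ⊆ closure (tentacle c A B) := by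
  rw [tentacle_eq_image c hA, tentacle_eq_image c fun h => hA (subset_closure h), ← closure_prod_eq]
  refine ContinuousOn.image_closure ?_
  have hne : ∀ p ∈ closure (A ×ˢ B), p.1 ^ 3 ≠ 0 := fun p hp => by
    rw [closure_prod_eq] at hp
    exact pow_ne_zero 3 (ne_of_mem_of_not_mem hp.1 hA)
  unfold tentaclePoint
  fun_prop (disch := assumption)

lemma isRegularSet_tentacle (c : ℝ) {A B : Set ℝ} (hA : IsOpen A) (hB : IsOpen B)
    (h0 : 0 ∉ closure A) : IsRegularSet (tentacle c (closure A) (closure B)) :=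
  ⟨tentacle c A B, isOpen_tentacle c hA hB, fun _ hp => ⟨subset_closure hp.1, subset_closure hp.2⟩,
    tentacle_closure_subset c h0 B⟩

lemma IsRegularSet.union {n : ℕ} {S S' : Set (Fin n → ℝ)} (hS : IsRegularSet S)
    (hS' : IsRegularSet S') : IsRegularSet (S ∪ S') := by
  obtain ⟨U, hU, hUS, hSU⟩ := hS
  obtain ⟨U', hU', hUS', hSU'⟩ := hS'
  refine ⟨U ∪ U', hU.union hU', Set.union_subset_union hUS hUS', ?_⟩
  rw [closure_union]
  exact Set.union_subset_union hSU hSU'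

theorem isRegularSet_tentacles : IsRegularSet (lowerTentacle ∪ upperTentacle) := by
  rw [lowerTentacle_eq, upperTentacle_eq, ← closure_Ioi, ← closure_Ioo one_lt_two.ne]
  have h0 : (0 : ℝ) ∉ closure (Set.Ioi 1) := by simp
  exact (isRegularSet_tentacle _ isOpen_Ioi isOpen_Ioo h0).union
    (isRegularSet_tentacle _ isOpen_Ioi isOpen_Ioo h0)

theorem isBasicClosed_tentacles : IsBasicClosed (lowerTentacle ∪ upperTentacle) := by
  classical
  let u : MvPolynomial (Fin 2) ℝ := X 0 ^ 3 * X 1 - X 0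
  -- The first three polynomials cut out the convex hull in `u` of the two tentacles, and the last
  -- one removes the gap between them.
  refine ⟨{X 0 - 1, u + X 0 ^ 6 - 1, 2 + X 0 ^ 6 - u, (u + X 0 ^ 6 - 2) * (u - X 0 ^ 6 - 1)}, ?_⟩
  ext p
  simp only [Set.mem_union, lowerTentacle, upperTentacle, Set.mem_ofPred_eq, Finset.mem_insert,
    Finset.mem_singleton, forall_eq_or_imp, forall_eq, u, map_sub, map_add, map_mul, map_pow,
    MvPolynomial.eval_X, map_one, map_ofNat]
  generalize p 0 ^ 3 * p 1 = v
  have hpow : 1 ≤ p 0 → 1 ≤ p 0 ^ 6 := fun h => one_le_pow₀ h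
  constructor
  · rintro (⟨h0, h1, h2⟩ | ⟨h0, h1, h2⟩) <;> have := hpow h0
    · exact ⟨by linarith, by linarith, by linarith,
        mul_nonneg_of_nonpos_of_nonpos (by linarith) (by linarith)⟩
    · exact ⟨by linarith, by linarith, by linarith, mul_nonneg (by linarith) (by linarith)⟩
  · rintro ⟨h0, h1, h2, h3⟩
    have := hpow (by linarith)
    rcases mul_nonneg_iff.mp h3 with ⟨-, hupper⟩ | ⟨hlower, -⟩
    · exact Or.inr ⟨by linarith, by linarith, by linarith⟩
    · exact Or.inl ⟨by linarith, by linarith, by linarith⟩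

/-! ### Polynomials on the tentacles -/

lemma curveEval_toCurve (x : ℝˣ) (t : ℝ) (f : MvPolynomial (Fin 2) ℝ) :
    curveEval x t (toCurve f) = eval (tentaclePoint 1 (x, t)) f := by
  have comp_eq : (curveEval x t).comp toCurve = MvPolynomial.aeval (tentaclePoint 1 (x, t)) := by
    refine MvPolynomial.algHom_ext fun i => ?_
    rw [AlgHom.comp_apply, MvPolynomial.aeval_X]
    fin_cases i
    · simp [toCurve_X_zero, curveEval_T, tentaclePoint]
    · simp [toCurve_X_one, xAddT, ← xtMonomial_zero_one, curveEval_T, curveEval_xtMonomial,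
        tentaclePoint, zpow_neg, div_eq_mul_inv]
  exact DFunLike.congr_fun comp_eq f

lemma eval_tentaclePoint_neg {f : MvPolynomial (Fin 2) ℝ} (hf : f ∈ evenPolynomials)
    (c a τ : ℝ) : eval (tentaclePoint c (-a, -τ)) f = eval (tentaclePoint (-c) (a, τ)) f := by
  have hneg : c * (-a) ^ 3 + (-a + -τ) / (-a) ^ 3 = -c * a ^ 3 + (a + τ) / a ^ 3 := by
    rw [Odd.neg_pow (by decide), ← neg_add, neg_div_neg_eq]
    ring
  rw [tentaclePoint, tentaclePoint, hneg]
  exact hf a _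

/- Even polynomials do not see the reflection which takes the lower tentacle to the continuation of
the upper one to `x ≤ -1`. -/
lemma curveEval_toCurve_of_even {c : ℝˣ} (hc : c = 1 ∨ c = -1) (a : ℝˣ) (τ : ℝ)
    {f : MvPolynomial (Fin 2) ℝ} (hf : f ∈ evenPolynomials) :
    curveEval (c * a) (c * τ) (toCurve f) = eval (tentaclePoint c (a, τ)) f := by
  rw [curveEval_toCurve]
  rcases hc with rfl | rfl
  · rw [one_mul, Units.val_one, one_mul]
  · simpa using eval_tentaclePoint_neg hf 1 a τ

lemma mem_tentacles_iff {p : Fin 2 → ℝ} : p ∈ lowerTentacle ∪ upperTentacle ↔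
    ∃ c : ℝˣ, (c = 1 ∨ c = -1) ∧ p ∈ tentacle c (Set.Ici 1) (Set.Icc 1 2) := by
  simp [lowerTentacle_eq, upperTentacle_eq, or_and_right, exists_or, or_comm]

lemma toCurve_add_smul_mem_of_bounded {c : ℝˣ} (hc : c = 1 ∨ c = -1)
    {f g : MvPolynomial (Fin 2) ℝ} (hf : f ∈ evenPolynomials) (hg : g ∈ evenPolynomials) {K : ℝ}
    (hK : ∀ p ∈ tentacle c (Set.Ici 1) (Set.Icc 1 2), |eval p (f + X 0 * g)| ≤ K) :
    toCurve f + (c : ℝ) • (T 1 * toCurve g) ∈ weightedDegreeLE ℝ 0 0 := by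
  have hc_sq : (c : ℝ) * c = 1 := by rcases hc with rfl | rfl <;> simp
  have hc_norm : ‖(c : ℝ)‖ = 1 := by rcases hc with rfl | rfl <;> simp
  let a (n : ℕ) : ℝˣ := Units.mk0 (n + 1) (by positivity)
  have ha : Tendsto (fun n => ‖((c * a n : ℝˣ) : ℝ)‖) atTop atTop := by
    simp only [Units.val_mul, norm_mul, hc_norm, one_mul, a, Units.val_mk0]
    exact tendsto_norm_atTop_atTop.comp
      (tendsto_atTop_add_const_right _ 1 tendsto_natCast_atTop_atTop)
  have hinfinite : ((fun τ => (c : ℝ) * τ) '' Set.Icc 1 2).Infinite :=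
    (Set.Icc_infinite one_lt_two).image (mul_right_injective₀ c.ne_zero).injOn
  refine mem_weightedDegreeLE_zero_of_bounded (K := K) ha hinfinite ?_
  rintro n _ ⟨τ, hτ, rfl⟩
  have hmem : tentaclePoint c (a n, τ) ∈ tentacle c (Set.Ici 1) (Set.Icc 1 2) :=
    tentaclePoint_mem_tentacle (a n).ne_zero (by simp [a]) hτ
  convert hK _ hmem using 2
  rw [map_add, map_add, map_smul, map_mul, map_mul, MvPolynomial.eval_X, curveEval_T,
    curveEval_toCurve_of_even hc _ _ hf, curveEval_toCurve_of_even hc _ _ hg, zpow_one,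
    Units.val_mul, smul_eq_mul]
  simp only [← mul_assoc, hc_sq, one_mul]
  rfl

lemma eq_zero_of_T_one_mul_toCurve_mem {N : ℕ} {g : MvPolynomial (Fin 2) ℝ} (hg : g ∈ evenSpan N)
    (h : T 1 * toCurve g ∈ weightedDegreeLE ℝ 0 0) : g = 0 := by
  have hbdd : toCurve g ∈ weightedDegreeLE ℝ 0 0 := by
    have := mul_mem_weightedDegreeLE (T_mem_weightedDegreeLE (R := ℝ) 0 (le_refl (-1))) h
    rw [← mul_assoc, ← LaurentPolynomial.T_add, neg_add_cancel, LaurentPolynomial.T_zero,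
      one_mul] at this
    exact weightedDegreeLE_mono (by norm_num) this
  obtain ⟨r, rfl⟩ := exists_C_eq_of_mem_evenSpan hg hbdd
  have hr : (T 1 * toCurve (MvPolynomial.C r)).coeff 1 = Polynomial.C r := by
    rw [← MvPolynomial.algebraMap_eq, AlgHom.commutes, mul_comm, LaurentPolynomial.algebraMap_apply,
      Polynomial.algebraMap_eq, ← LaurentPolynomial.single_eq_C_mul_T,
      AddMonoidAlgebra.coeff_single, Finsupp.single_eq_same]
  rw [mem_weightedDegreeLE_zero_iff.mp h 1 one_pos] at hr
  rw [Polynomial.C_eq_zero.mp hr.symm, MvPolynomial.C_0]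

lemma exists_C_eq_of_bounded {p : MvPolynomial (Fin 2) ℝ} {K : ℝ}
    (hK : ∀ x ∈ lowerTentacle ∪ upperTentacle, |eval x p| ≤ K) : ∃ r, MvPolynomial.C r = p := by
  obtain ⟨N, f, hf, g, hg, rfl⟩ := exists_eq_add_X_zero_mul p
  have hf' := evenSpan_le_evenPolynomials N hf
  have hg' := evenSpan_le_evenPolynomials N hg
  have upper : toCurve f + T 1 * toCurve g ∈ weightedDegreeLE ℝ 0 0 := by
    simpa using toCurve_add_smul_mem_of_bounded (.inl rfl) hf' hg'
      fun x hx => hK x (mem_tentacles_iff.mpr ⟨1, .inl rfl, hx⟩)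
  have lower : toCurve f - T 1 * toCurve g ∈ weightedDegreeLE ℝ 0 0 := by
    simpa [sub_eq_add_neg] using toCurve_add_smul_mem_of_bounded (.inr rfl) hf' hg'
      fun x hx => hK x (mem_tentacles_iff.mpr ⟨-1, .inr rfl, hx⟩)
  have even_part : toCurve f = (1 / 2 : ℝ) •
      ((toCurve f + T 1 * toCurve g) + (toCurve f - T 1 * toCurve g)) := by module
  have odd_part : T 1 * toCurve g = (1 / 2 : ℝ) •
      ((toCurve f + T 1 * toCurve g) - (toCurve f - T 1 * toCurve g)) := by module
  obtain rfl : g = 0 := eq_zero_of_T_one_mul_toCurve_mem hg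
    (odd_part ▸ Submodule.smul_mem _ _ (sub_mem upper lower))
  rw [mul_zero, add_zero]
  exact exists_C_eq_of_mem_evenSpan hf (even_part ▸ Submodule.smul_mem _ _ (add_mem upper lower))

theorem growthModule_zero_tentacles :
    (GrowthModule (lowerTentacle ∪ upperTentacle) 0 : Set (MvPolynomial (Fin 2) ℝ)) =
      Set.range (MvPolynomial.C : ℝ →+* MvPolynomial (Fin 2) ℝ) := by
  ext p
  constructor
  · rintro ⟨q, hq, hpq⟩
    obtain ⟨r, rfl⟩ : ∃ r, q = MvPolynomial.C r :=
      ⟨_, MvPolynomial.totalDegree_eq_zero_iff_eq_C.mp (Nat.le_zero.mp hq)⟩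
    refine exists_C_eq_of_bounded (K := √r) fun x hx => Real.abs_le_sqrt ?_
    simpa only [MvPolynomial.eval_C] using hpq x hx
  · rintro ⟨r, rfl⟩
    exact ⟨MvPolynomial.C (r ^ 2), by rw [MvPolynomial.totalDegree_C], fun x _ => by simp⟩

lemma exists_forall_abs_eval_le {d : ℕ} {f : MvPolynomial (Fin 2) ℝ}
    (hf : f ∈ evenPolynomials) (hd : toCurve f ∈ weightedDegreeLE ℝ 0 d) :
    ∃ K, ∀ p ∈ lowerTentacle ∪ upperTentacle, |eval p f| ≤ K * p 0 ^ d := by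
  obtain ⟨K, hK⟩ := exists_forall_norm_curveEval_le hd 2
  refine ⟨K, fun p hp => ?_⟩
  obtain ⟨c, hc, hp⟩ := mem_tentacles_iff.mp hp
  have h0 : (0 : ℝ) < p 0 := one_pos.trans_le hp.1
  obtain ⟨a, ha, τ, ⟨hτ, hτ'⟩, rfl⟩ := exists_eq_tentaclePoint hp h0.ne'
  lift a to ℝˣ using h0.ne'.isUnit
  have hc_norm : ‖(c : ℝ)‖ = 1 := by rcases hc with rfl | rfl <;> simp
  have ha_pos : (0 : ℝ) < a := h0
  have ha_norm : ‖((c * a : ℝˣ) : ℝ)‖ = a := by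
    rw [Units.val_mul, norm_mul, hc_norm, one_mul, Real.norm_of_nonneg ha_pos.le]
  have hτ_norm : ‖(c : ℝ) * τ‖ ≤ 2 := by
    rwa [norm_mul, hc_norm, one_mul, Real.norm_of_nonneg (by linarith)]
  have h := hK (c * a) (c * τ) (ha_norm ▸ ha) hτ_norm
  rwa [ha_norm, curveEval_toCurve_of_even hc a τ hf] at h

lemma pow_six_le {p : Fin 2 → ℝ} (hp : p ∈ lowerTentacle ∪ upperTentacle) :
    p 0 ^ 6 ≤ 2 * p 1 ^ 2 + 18 := by
  obtain ⟨c, hc, hp⟩ := mem_tentacles_iff.mp hp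
  have h0 : (0 : ℝ) < p 0 := one_pos.trans_le hp.1
  obtain ⟨a, ha, τ, ⟨hτ, hτ'⟩, rfl⟩ := exists_eq_tentaclePoint hp h0.ne'
  replace ha : 1 ≤ a := ha
  have hc_sq : (c : ℝ) ^ 2 = 1 := by rcases hc with rfl | rfl <;> simp
  simp only [tentaclePoint, Matrix.cons_val_zero, Matrix.cons_val_one, Matrix.cons_val_fin_one]
  set δ := (a + τ) / a ^ 3
  have hδ : 0 ≤ δ := by positivity
  have hδ' : δ ≤ 3 := by
    have ha_cube : a ≤ a ^ 3 := le_self_pow₀ ha (by norm_num)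
    rw [div_le_iff₀ (by positivity)]
    linarith
  have hδ_sq : δ ^ 2 ≤ 9 := by nlinarith
  calc a ^ 6 = (c : ℝ) ^ 2 * a ^ 6 := by rw [hc_sq, one_mul]
    _ ≤ (c : ℝ) ^ 2 * a ^ 6 + (c * a ^ 3 + 2 * δ) ^ 2 + 2 * (9 - δ ^ 2) := by nlinarith
    _ = 2 * (c * a ^ 3 + δ) ^ 2 + 18 := by ring

lemma mem_growthModule_one_of_even {f : MvPolynomial (Fin 2) ℝ} (hf : f ∈ evenPolynomials)
    (hd : toCurve f ∈ weightedDegreeLE ℝ 0 3) :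
    f ∈ GrowthModule (lowerTentacle ∪ upperTentacle) 1 := by
  obtain ⟨K, hK⟩ := exists_forall_abs_eval_le hf (d := 3) hd
  refine ⟨K ^ 2 • ((2 : ℝ) • X 1 ^ 2 + MvPolynomial.C 18), ?_, fun p hp => ?_⟩
  · refine (MvPolynomial.totalDegree_smul_le _ _).trans ?_
    refine (MvPolynomial.totalDegree_add _ _).trans (max_le ?_ ?_)
    · exact (MvPolynomial.totalDegree_smul_le _ _).trans (MvPolynomial.totalDegree_X_pow 1 2).le
    · rw [MvPolynomial.totalDegree_C]
      exact Nat.zero_le _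
  · calc eval p f ^ 2 = |eval p f| ^ 2 := (sq_abs _).symm
      _ ≤ (K * p 0 ^ 3) ^ 2 := pow_le_pow_left₀ (abs_nonneg _) (hK p hp) 2
      _ = K ^ 2 * p 0 ^ 6 := by ring
      _ ≤ K ^ 2 * (2 * p 1 ^ 2 + 18) := mul_le_mul_of_nonneg_left (pow_six_le hp) (sq_nonneg K)
      _ = eval p (K ^ 2 • ((2 : ℝ) • X 1 ^ 2 + MvPolynomial.C 18)) := by
        simp only [MvPolynomial.smul_eval, map_add, map_pow, MvPolynomial.eval_X,
          MvPolynomial.eval_C]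

lemma exists_mem_growthModule_one_coeff_two_eq (g : ℝ[X]) :
    ∃ f ∈ GrowthModule (lowerTentacle ∪ upperTentacle) 1, (toCurve f).coeff 2 = g := by
  have hdeg : LaurentPolynomial.C g * T 2 ∈ weightedDegreeLE ℝ 1 (2 + g.natDegree : ℕ) :=
    C_mul_T_mem_weightedDegreeLE (by simp)
  obtain ⟨_, ⟨f, hf, rfl⟩, r, hr, hsum⟩ :=
    Submodule.mem_sup.mp (weightedDegreeLE_one_le_map_evenPolynomials_sup _ hdeg)
  have hf_eq : toCurve f = LaurentPolynomial.C g * T 2 - r := eq_sub_of_add_eq hsum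
  refine ⟨f, mem_growthModule_one_of_even hf ?_, ?_⟩
  · rw [hf_eq]
    exact sub_mem (C_mul_T_mem_weightedDegreeLE (by simp))
      (weightedDegreeLE_mono (by norm_num) hr)
  · rw [hf_eq, AddMonoidAlgebra.coeff_sub, Finsupp.sub_apply,
      mem_weightedDegreeLE_zero_iff.mp hr 2 one_lt_two, sub_zero,
      ← LaurentPolynomial.single_eq_C_mul_T, AddMonoidAlgebra.coeff_single, Finsupp.single_eq_same]

theorem not_finite_growthModule_one_tentacles :
    ¬ Module.Finite ℝ (GrowthModule (lowerTentacle ∪ upperTentacle) 1) := by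
  intro hfin
  let coeffTwo : ℝ[X][T;T⁻¹] →ₗ[ℝ] ℝ[X] :=
    { toFun h := h.coeff 2
      map_add' := by simp
      map_smul' := by simp }
  refine Polynomial.not_finite (R := ℝ) <| Module.Finite.of_surjective
    ((coeffTwo ∘ₗ toCurve.toLinearMap) ∘ₗ
      (GrowthModule (lowerTentacle ∪ upperTentacle) 1).subtype) fun g => ?_
  obtain ⟨f, hf, hfg⟩ := exists_mem_growthModule_one_coeff_two_eq g
  exact ⟨⟨f, hf⟩, hfg⟩

theorem mainTheorem3 :
    IsBasicClosed (lowerTentacle ∪ upperTentacle) ∧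
    IsRegularSet (lowerTentacle ∪ upperTentacle) ∧
    (GrowthModule (lowerTentacle ∪ upperTentacle) 0 : Set (MvPolynomial (Fin 2) ℝ)) =
      Set.range (MvPolynomial.C : ℝ →+* MvPolynomial (Fin 2) ℝ) ∧
    ¬ Module.Finite ℝ (GrowthModule (lowerTentacle ∪ upperTentacle) 1) :=
  ⟨isBasicClosed_tentacles, isRegularSet_tentacles, growthModule_zero_tentacles,
    not_finite_growthModule_one_tentacles⟩
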